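/- Let $M_2$ be the algebra of complex $2\times2$ matrices and let $(\mathcal T_t)_{t\ge0}$ be a quantum Markov semigroup on $M_2$, i.e. a weak$^*$-continuous one-parameter semigroup of completely positive linear maps on $M_2$ with $\mathcal T_t(I)=I$. For a state $\omega$ put $\mathcal T_{*t}(\omega)=\omega\circ\mathcal T_t$. A state $\omega_\infty$ is absorbing if $\lim_{t\to\infty}\mathcal T_{*t}(\omega)=\omega_\infty$ (weak$^*$) for every state $\omega$. Let $P$ be the pure state space of $M_2$ with the weak$^*$ topology. An orthogonal measure representing a state $\omega_\rho=\mathrm{tr}(\rho\,\cdot)$ is a Borel measure $a_1\delta_{\omega_{|e_1\rangle\langle e_1|}}+a_2\delta_{\omega_{|e_2\rangle\langle e_2|}}$ on $P$, where $\rho=a_1|e_1\rangle\langle e_1|+a_2|e_2\rangle\langle e_2|$, $(e_1,e_2)$ is an orthonormal basis of $\mathbb C^2$ and $a_1,a_2\ge0$ (it is unique if $\rho\ne\frac12I$). A net $(\mu_t)_{t\ge0}$ of Borel probability measures on $P$ satisfies a large deviation principle (LDP) with powers $(1/t)$ and rate function $J$ if $J:P\to[0,+\infty]$ is lower semicontinuous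 and, as $t\to\infty$, $$\limsup_t\mu_t(F)^{1/t}\le\sup_{x\in F}e^{-J(x)}\ (F\subset P\text{ closed}),\qquad \sup_{x\in G}e^{-J(x)}\le\liminf_t\mu_t(G)^{1/t}\ (G\subset P\text{ open}),$$ with $\sup\emptyset=0$. The following statements are equivalent. (i) $(\mathcal T_t)$ admits an absorbing pure state. (ii) There is a function $J:P\to[0,+\infty]$ vanishing at a unique point such that, for each state $\omega$ distinct from this point, every net $(\mu_t)_{t\ge0}$ of orthogonal measures, $\mu_t$ representing $\mathcal T_{*t}(\omega)$, satisfies an LDP with powers $(1/t)$ and rate function $J$. (ii$'$) The same as (ii), with "every net" replaced by "some net". Moreover, whenever $J$ is as in (ii) or (ii$'$), the point where $J$ vanishes is an absorbing state, and it is the only absorbing state. -/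

import Mathlib

open scoped NNReal ENNReal Topology Matrix MatrixOrder ComplexOrder CStarAlgebra
  Matrix.Norms.L2Operator

/-- The full algebra `M₂` of complex `2 × 2` matrices, with its C⋆-algebra structure. -/
abbrev M₂ : Type := Matrix (Fin 2) (Fin 2) ℂ

/-- The continuous (i.e. all) linear functionals on `M₂`, with the weak⋆ topology. -/
abbrev Functional : Type := WeakDual ℂ M₂

/-- The states of `M₂`: the positive linear functionals taking the value `1` at the identity. -/
def stateSpace : Set Functional :=
  {ω | (∀ x : M₂, 0 ≤ x → 0 ≤ ω x) ∧ ω 1 = 1}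

/-- The pure state space `P` of `M₂`, consisting of the extreme points of the set of all states.
It carries the weak⋆ topology, as a subspace of `Functional`. -/
abbrev PureState : Type := (stateSpace.extremePoints ℝ : Set Functional)

/-- Measures on the pure state space are Borel measures. -/
noncomputable instance : MeasurableSpace PureState := borel PureState

instance : BorelSpace PureState := ⟨rfl⟩

/-- A quantum Markov semigroup on `M₂`: a weak⋆-continuous one-parameter semigroup
`(T_t)_{t ≥ 0}` of completely positive linear maps preserving the identity. Since `M₂` is its own
bidual, weak⋆ continuity means that `t ↦ φ (T_t x)` is continuous for each functional `φ`. -/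
structure QuantumMarkovSemigroup where
  /-- The map `T_t`. -/
  T : ℝ≥0 → (M₂ →CP M₂)
  map_zero : ∀ x, T 0 x = x
  map_add : ∀ s t x, T (s + t) x = T s (T t x)
  map_one : ∀ t, T t 1 = 1
  weakStarContinuous : ∀ (φ : Functional) (x : M₂), Continuous fun t => φ (T t x)

namespace QuantumMarkovSemigroup

/-- The predual semigroup `T_{*t}(ω) = ω ∘ T_t`. -/
noncomputable def predual (S : QuantumMarkovSemigroup) (t : ℝ≥0) (ω : Functional) : Functional :=
  LinearMap.toContinuousLinearMap ((ω : M₂ →L[ℂ] ℂ).toLinearMap ∘ₗ (S.T t).toLinearMap)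

/-- A state `σ` is absorbing if `T_{*t}(ω) → σ` in the weak⋆ topology for all states `ω`. -/
def IsAbsorbing (S : QuantumMarkovSemigroup) (σ : Functional) : Prop :=
  σ ∈ stateSpace ∧
    ∀ ω ∈ stateSpace, Filter.Tendsto (fun t => S.predual t ω) Filter.atTop (𝓝 σ)

end QuantumMarkovSemigroup

/-- `IsVectorState p e` says that `p` is the state `x ↦ ⟨e, x e⟩`, i.e. the state
`ω_{|e⟩⟨e|}`. -/
def IsVectorState (p : Functional) (e : EuclideanSpace ℂ (Fin 2)) : Prop :=
  ∀ x : M₂, p x = inner ℂ e (Matrix.toEuclideanLin x e)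

/-- `IsOrthogonalMeasure μ ω` says that `μ` is an orthogonal measure representing `ω`: the state
`ω = ω_ρ` has a diagonal form `ρ = a₀ |e₀⟩⟨e₀| + a₁ |e₁⟩⟨e₁|` with `(e₀, e₁)` an orthonormal basis
and `a₀, a₁ ≥ 0`, and `μ = a₀ δ_{p₀} + a₁ δ_{p₁}` with `pᵢ` the pure state `ω_{|eᵢ⟩⟨eᵢ|}`. -/
def IsOrthogonalMeasure (μ : MeasureTheory.Measure PureState) (ω : Functional) : Prop :=
  ∃ (a : Fin 2 → ℝ≥0) (e : OrthonormalBasis (Fin 2) ℂ (EuclideanSpace ℂ (Fin 2)))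
    (p : Fin 2 → PureState),
    (∀ i, IsVectorState (p i) (e i)) ∧
    (∀ x : M₂, ω x = ∑ i, ((a i : ℝ) : ℂ) * (p i : Functional) x) ∧
    μ = ∑ i, a i • MeasureTheory.Measure.dirac (p i)

/-- The net `(μ_t)_{t ≥ 0}` of Borel measures satisfies a large deviation principle with powers
`(1/t)` and rate function `J`. Here `EReal.exp (-J)` is `e^{-J}` with `e^{-∞} = 0`, and the
suprema, taken in `[0, ∞]`, are `0` over the empty set. -/
def SatisfiesLDP {X : Type*} [TopologicalSpace X] [MeasurableSpace X]
    (μ : ℝ≥0 → MeasureTheory.Measure X) (J : X → ℝ≥0∞) : Prop :=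
  LowerSemicontinuous J ∧
  (∀ F : Set X, IsClosed F →
    Filter.limsup (fun t : ℝ≥0 => (μ t F) ^ (1 / (t : ℝ))) Filter.atTop ≤
      ⨆ x ∈ F, EReal.exp (-(J x : EReal))) ∧
  (∀ G : Set X, IsOpen G →
    ⨆ x ∈ G, EReal.exp (-(J x : EReal)) ≤
      Filter.liminf (fun t : ℝ≥0 => (μ t G) ^ (1 / (t : ℝ))) Filter.atTop)

/-- `EveryOrthogonalNetLDP S ω J`: every net of orthogonal measures representing
`(T_{*t}(ω))_{t ≥ 0}` satisfies the large deviation principle with rate function `J`. -/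
def EveryOrthogonalNetLDP (S : QuantumMarkovSemigroup) (ω : Functional) (J : PureState → ℝ≥0∞) :
    Prop :=
  ∀ μ : ℝ≥0 → MeasureTheory.Measure PureState,
    (∀ t, IsOrthogonalMeasure (μ t) (S.predual t ω)) → SatisfiesLDP μ J

/-- `SomeOrthogonalNetLDP S ω J`: some net of orthogonal measures representing
`(T_{*t}(ω))_{t ≥ 0}` satisfies the large deviation principle with rate function `J`. -/
def SomeOrthogonalNetLDP (S : QuantumMarkovSemigroup) (ω : Functional) (J : PureState → ℝ≥0∞) :
    Prop :=
  ∃ μ : ℝ≥0 → MeasureTheory.Measure PureState,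
    (∀ t, IsOrthogonalMeasure (μ t) (S.predual t ω)) ∧ SatisfiesLDP μ J

/-! If the vector state of `e 0` is absorbing, it is invariant, so `T_t` maps `|e₁⟩⟨e₁|` to a
multiple of itself (`map_ketbra_one_one`), with a factor `decay` that is multiplicative in time and
tends to `0`. Hence `decay = exp(-at)` with `a > 0`. The population of `e 1`, and with it the
smaller eigenvalue of the density matrix at time `t`, is `O(exp(-at))`.

The hard point is a matching lower bound. The determinant is the product of the eigenvalues and the
larger one lies in `[1/2, 1]`, so it suffices that the determinant dominates a multiple of `decay`
(`eventually_le_stateDet`). Kadison–Schwarz bounds the off-diagonal dynamics by `|coherence|² +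
|leakage|² ≤ decay`. By `coherence_dichotomy`, either coherence and leakage are both negligible
against the square root of `decay`, or the bound is saturated and leakage vanishes; the determinant
survives in both cases. The small weight is thus of exact order `exp(-at)`, the eigenvectors
converge to `e 1` and `e 0`, and the rate function is `a` and `0` at these two points, infinite
elsewhere.

Conversely, `P` is compact, so an LDP whose rate vanishes only at `p` makes the mass outside each
neighbourhood of `p` exponentially small, and the represented states converge to `p`. The excluded
initial state `p` is recovered by linearity (`isAbsorbing_of_forall_ne`). -/

/-! ### Rank-one operators and matrix units. -/

/-- The Hilbert space `ℂ²`. -/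
abbrev Qubit : Type := EuclideanSpace ℂ (Fin 2)

/-- The operator `|v⟩⟨w|` on `ℂ²`. -/
noncomputable def ketbra (v w : Qubit) : M₂ := Matrix.vecMulVec v.ofLp (star w.ofLp)

theorem ketbra_mul_ketbra (u v w z : Qubit) :
    ketbra u v * ketbra w z = inner ℂ v w • ketbra u z := by
  rw [ketbra, ketbra, Matrix.vecMulVec_mul_vecMulVec, EuclideanSpace.inner_eq_star_dotProduct,
    ketbra, dotProduct_comm]
  ext i j
  simp [Matrix.vecMulVec_apply]
  ring

theorem star_ketbra (v w : Qubit) : star (ketbra v w) = ketbra w v := by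
  simp [ketbra, Matrix.star_eq_conjTranspose, Matrix.conjTranspose_vecMulVec]

theorem toEuclideanLin_ketbra (v w z : Qubit) :
    Matrix.toEuclideanLin (ketbra v w) z = inner ℂ w z • v := by
  ext i
  simp [ketbra, Matrix.vecMulVec_mulVec, EuclideanSpace.inner_eq_star_dotProduct,
    dotProduct_comm, mul_comm]

theorem inner_toEuclideanLin_star (x : M₂) (v w : Qubit) :
    inner ℂ v (Matrix.toEuclideanLin (star x) w) = inner ℂ (Matrix.toEuclideanLin x v) w := by
  rw [Matrix.star_eq_conjTranspose, Matrix.toEuclideanLin_conjTranspose_eq_adjoint,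
    LinearMap.adjoint_inner_right]

theorem toEuclideanLin_mul (x y : M₂) (v : Qubit) :
    Matrix.toEuclideanLin (x * y) v = Matrix.toEuclideanLin x (Matrix.toEuclideanLin y v) := by
  ext i
  simp

theorem toEuclideanLin_one (v : Qubit) : Matrix.toEuclideanLin (1 : M₂) v = v := by
  ext i
  simp

/-- Every matrix is the linear combination of the operators `|e_i⟩⟨e_j|` with its matrix entries as
coefficients. -/
theorem eq_sum_ketbra (e : OrthonormalBasis (Fin 2) ℂ Qubit) (x : M₂) :
    x = ∑ i, ∑ j, inner ℂ (e i) (Matrix.toEuclideanLin x (e j)) • ketbra (e i) (e j) := by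
  apply Matrix.toEuclideanLin.injective
  refine e.toBasis.ext fun k => ?_
  simp only [OrthonormalBasis.coe_toBasis, map_sum, map_smul, LinearMap.sum_apply,
    LinearMap.smul_apply, toEuclideanLin_ketbra, e.inner_eq_ite, ite_smul, one_smul, zero_smul,
    smul_ite, smul_zero, Finset.sum_ite_eq', Finset.mem_univ, if_true]
  exact (e.sum_repr' _).symm

theorem sum_ketbra_self (e : OrthonormalBasis (Fin 2) ℂ Qubit) :
    ketbra (e 0) (e 0) + ketbra (e 1) (e 1) = 1 := by
  have := eq_sum_ketbra e 1
  simp [e.inner_eq_ite] at this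
  exact this.symm

theorem ketbra_self_nonneg (v : Qubit) : 0 ≤ ketbra v v :=
  (Matrix.posSemidef_vecMulVec_self_star _).nonneg

theorem inner_toEuclideanLin_nonneg {x : M₂} (hx : 0 ≤ x) (v : Qubit) :
    0 ≤ inner ℂ v (Matrix.toEuclideanLin x v) := by
  rw [EuclideanSpace.inner_eq_star_dotProduct, dotProduct_comm, Matrix.ofLp_toLpLin,
    Matrix.toLin'_apply]
  exact (Matrix.nonneg_iff_posSemidef.mp hx).dotProduct_mulVec_nonneg _

theorem map_eq_sum_ketbra (e : OrthonormalBasis (Fin 2) ℂ Qubit) (ω : Functional) (x : M₂) :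
    ω x = ∑ i, ∑ j, inner ℂ (e i) (Matrix.toEuclideanLin x (e j)) * ω (ketbra (e i) (e j)) := by
  conv_lhs => rw [eq_sum_ketbra e x]
  simp [map_smul]

/-! ### States -/

/-- A state, as a positive linear map. -/
noncomputable def statePositiveMap (ω : Functional) (hω : ω ∈ stateSpace) : M₂ →ₚ[ℂ] ℂ :=
  PositiveLinearMap.mk₀ (ω : M₂ →L[ℂ] ℂ).toLinearMap hω.1

theorem state_map_star {ω : Functional} (hω : ω ∈ stateSpace) (x : M₂) :
    ω (star x) = star (ω x) :=
  map_star (statePositiveMap ω hω) x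

/-- This is Cauchy–Schwarz for the GNS semi-inner product of `ω`. -/
theorem state_cauchySchwarz {ω : Functional} (hω : ω ∈ stateSpace) (x y : M₂) :
    ‖ω (star x * y)‖ ^ 2 ≤ (ω (star x * x)).re * (ω (star y * y)).re := by
  set f := statePositiveMap ω hω
  have h := norm_inner_le_norm (𝕜 := ℂ) (f.toPreGNS x) (f.toPreGNS y)
  have h2 := pow_le_pow_left₀ (norm_nonneg _) h 2
  rw [mul_pow, PositiveLinearMap.preGNS_norm_def, PositiveLinearMap.preGNS_norm_def,
    Real.sq_sqrt, Real.sq_sqrt] at h2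
  · exact h2
  · exact (hω.1 _ (star_mul_self_nonneg y)).1
  · exact (hω.1 _ (star_mul_self_nonneg x)).1

theorem state_ketbra_eq_re {ω : Functional} (hω : ω ∈ stateSpace) (v : Qubit) :
    ω (ketbra v v) = ((ω (ketbra v v)).re : ℂ) :=
  Complex.ext rfl (hω.1 _ (ketbra_self_nonneg v)).2.symm

theorem state_ketbra_re_nonneg {ω : Functional} (hω : ω ∈ stateSpace) (v : Qubit) :
    0 ≤ (ω (ketbra v v)).re :=
  (hω.1 _ (ketbra_self_nonneg v)).1

theorem state_ketbra_re_add {ω : Functional} (hω : ω ∈ stateSpace)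
    (e : OrthonormalBasis (Fin 2) ℂ Qubit) :
    (ω (ketbra (e 0) (e 0))).re + (ω (ketbra (e 1) (e 1))).re = 1 := by
  rw [← Complex.add_re, ← map_add, sum_ketbra_self, hω.2, Complex.one_re]

theorem state_ketbra_offDiag {ω : Functional} (hω : ω ∈ stateSpace)
    (e : OrthonormalBasis (Fin 2) ℂ Qubit) :
    ‖ω (ketbra (e 0) (e 1))‖ ^ 2 ≤ (ω (ketbra (e 0) (e 0))).re * (ω (ketbra (e 1) (e 1))).re := by
  have h := state_cauchySchwarz hω (ketbra (e 0) (e 0)) (ketbra (e 0) (e 1))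
  simpa [star_ketbra, ketbra_mul_ketbra, e.inner_eq_ite] using h

theorem state_ketbra_swap {ω : Functional} (hω : ω ∈ stateSpace) (v w : Qubit) :
    ω (ketbra w v) = star (ω (ketbra v w)) := by
  rw [← star_ketbra, state_map_star hω]

/-! ### Vector states -/

/-- The functional `x ↦ ⟨v, x w⟩`. -/
noncomputable def matrixFunctional (v w : Qubit) : Functional :=
  LinearMap.toContinuousLinearMap
    ((innerₛₗ ℂ v) ∘ₗ (LinearMap.applyₗ w) ∘ₗ Matrix.toEuclideanLin.toLinearMap)

theorem matrixFunctional_apply (v w : Qubit) (x : M₂) :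
    matrixFunctional v w x = inner ℂ v (Matrix.toEuclideanLin x w) := rfl

theorem matrixFunctional_ketbra (u z v w : Qubit) :
    matrixFunctional u z (ketbra v w) = inner ℂ w z * inner ℂ u v := by
  rw [matrixFunctional_apply, toEuclideanLin_ketbra, inner_smul_right]

/-- The functional `x ↦ ⟨v, x v⟩`. -/
noncomputable def vectorFunctional (v : Qubit) : Functional := matrixFunctional v v

theorem vectorFunctional_apply (v : Qubit) (x : M₂) :
    vectorFunctional v x = inner ℂ v (Matrix.toEuclideanLin x v) := rfl

theorem isVectorState_iff {p : Functional} {v : Qubit} :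
    IsVectorState p v ↔ p = vectorFunctional v :=
  ⟨fun h => DFunLike.ext _ _ h, fun h x => by rw [h, vectorFunctional_apply]⟩

theorem vectorFunctional_ketbra (u v w : Qubit) :
    vectorFunctional u (ketbra v w) = inner ℂ w u * inner ℂ u v :=
  matrixFunctional_ketbra u u v w

theorem vectorFunctional_mem_stateSpace {v : Qubit} (hv : ‖v‖ = 1) :
    vectorFunctional v ∈ stateSpace :=
  ⟨fun _ hx => inner_toEuclideanLin_nonneg hx v, by
    rw [vectorFunctional_apply, toEuclideanLin_one, inner_self_eq_norm_sq_to_K, hv]; simp⟩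

/-- Zero population at `e 1` forces the off-diagonal entries to vanish, by `state_ketbra_offDiag`.
-/
theorem eq_vectorFunctional {ω : Functional} (hω : ω ∈ stateSpace)
    (e : OrthonormalBasis (Fin 2) ℂ Qubit) (h : (ω (ketbra (e 1) (e 1))).re = 0) :
    ω = vectorFunctional (e 0) := by
  have h0 : (ω (ketbra (e 0) (e 0))).re = 1 := by linarith [state_ketbra_re_add hω e]
  have h2 := state_ketbra_offDiag hω e
  have h01 : ω (ketbra (e 0) (e 1)) = 0 := by
    rw [h, mul_zero] at h2
    simpa using le_antisymm h2 (by positivity)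
  have h10 : ω (ketbra (e 1) (e 0)) = 0 := by rw [state_ketbra_swap hω, h01, star_zero]
  refine DFunLike.ext _ _ fun x => ?_
  rw [map_eq_sum_ketbra e, vectorFunctional_apply]
  simp only [Fin.sum_univ_two]
  rw [h01, h10, state_ketbra_eq_re hω (e 0), state_ketbra_eq_re hω (e 1), h, h0]
  simp

/-- The population of `e 1` is nonnegative on states and affine, so its vanishing at a proper convex
combination forces it to vanish at both components. -/
theorem isPure_vectorFunctional (e : OrthonormalBasis (Fin 2) ℂ Qubit) :
    vectorFunctional (e 0) ∈ stateSpace.extremePoints ℝ := by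
  rw [mem_extremePoints]
  refine ⟨vectorFunctional_mem_stateSpace (e.orthonormal.1 0), ?_⟩
  rintro ω₁ h₁ ω₂ h₂ ⟨a, b, ha, hb, -, h⟩
  have hz : a * (ω₁ (ketbra (e 1) (e 1))).re + b * (ω₂ (ketbra (e 1) (e 1))).re = 0 := by
    have := congrArg (fun ω : Functional => (ω (ketbra (e 1) (e 1))).re) h
    simp only [vectorFunctional_ketbra, e.inner_eq_ite] at this
    change (a • ω₁ (ketbra (e 1) (e 1)) + b • ω₂ (ketbra (e 1) (e 1))).re = _ at this
    simpa using this
  have k₁ := mul_nonneg ha.le (state_ketbra_re_nonneg h₁ (e 1))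
  have k₂ := mul_nonneg hb.le (state_ketbra_re_nonneg h₂ (e 1))
  have z₁ : a * (ω₁ (ketbra (e 1) (e 1))).re = 0 := by linarith
  have z₂ : b * (ω₂ (ketbra (e 1) (e 1))).re = 0 := by linarith
  exact ⟨eq_vectorFunctional h₁ e ((mul_eq_zero.mp z₁).resolve_left ha.ne'),
    eq_vectorFunctional h₂ e ((mul_eq_zero.mp z₂).resolve_left hb.ne')⟩

/-- The basis with its two vectors exchanged. -/
noncomputable def swapBasis (e : OrthonormalBasis (Fin 2) ℂ Qubit) :
    OrthonormalBasis (Fin 2) ℂ Qubit := e.reindex (Equiv.swap 0 1)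

@[simp] theorem swapBasis_zero (e : OrthonormalBasis (Fin 2) ℂ Qubit) : swapBasis e 0 = e 1 := by
  simp [swapBasis]

@[simp] theorem swapBasis_one (e : OrthonormalBasis (Fin 2) ℂ Qubit) : swapBasis e 1 = e 0 := by
  simp [swapBasis]

/-- The vector states of the members of an orthonormal basis, as pure states. -/
noncomputable def basisState (e : OrthonormalBasis (Fin 2) ℂ Qubit) (i : Fin 2) : PureState :=
  ⟨vectorFunctional (e i), by
    fin_cases i
    · exact isPure_vectorFunctional e
    · simpa using isPure_vectorFunctional (swapBasis e)⟩

/-- The spectral decomposition of a state. -/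
theorem exists_spectral_decomposition {ω : Functional} (hω : ω ∈ stateSpace) :
    ∃ (a : Fin 2 → ℝ≥0) (e : OrthonormalBasis (Fin 2) ℂ Qubit),
      ∀ x : M₂, ω x = ∑ i, ((a i : ℝ) : ℂ) * vectorFunctional (e i) x := by
  -- The indices are transposed so that `ω x` is the trace of `ρ * x`.
  let ρ : M₂ := Matrix.of fun i j => ω (Matrix.single j i 1)
  have hρ : ρ.IsHermitian := by
    ext i j
    rw [Matrix.conjTranspose_apply]
    change star (ω (Matrix.single i j 1)) = ω (Matrix.single j i 1)
    rw [← state_map_star hω]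
    simp [Matrix.star_eq_conjTranspose, Matrix.conjTranspose_single]
  have htr : ∀ x : M₂, ω x = (ρ * x).trace := by
    intro x
    conv_lhs => rw [Matrix.matrix_eq_sum_single x]
    have : ∀ i j, Matrix.single i j (x i j) = x i j • Matrix.single i j (1 : ℂ) := by simp
    simp only [this, map_sum, map_smul, Matrix.trace, Matrix.diag, Matrix.mul_apply, smul_eq_mul]
    rw [Finset.sum_comm]
    refine Finset.sum_congr rfl fun i _ => Finset.sum_congr rfl fun j _ => ?_
    exact mul_comm _ _
  let e := hρ.eigenvectorBasis
  have hρk : ∀ i j, ρ * ketbra (e i) (e j) = (hρ.eigenvalues i : ℂ) • ketbra (e i) (e j) := by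
    intro i j
    rw [ketbra, Matrix.mul_vecMulVec, hρ.mulVec_eigenvectorBasis]
    ext k l
    simp [Matrix.vecMulVec_apply]
    ring
  have htk : ∀ i j, (ketbra (e i) (e j)).trace = if i = j then 1 else 0 := by
    intro i j
    rw [ketbra, Matrix.trace_vecMulVec, ← EuclideanSpace.inner_eq_star_dotProduct, e.inner_eq_ite]
    simp [eq_comm]
  have hval : ∀ i j, ω (ketbra (e i) (e j)) = if i = j then (hρ.eigenvalues i : ℂ) else 0 := by
    intro i j
    rw [htr, hρk, Matrix.trace_smul, htk]
    simp
  have hnn : ∀ i, 0 ≤ hρ.eigenvalues i := by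
    intro i
    have := state_ketbra_re_nonneg hω (e i)
    simpa [hval] using this
  refine ⟨fun i => ⟨hρ.eigenvalues i, hnn i⟩, e, fun x => ?_⟩
  rw [map_eq_sum_ketbra e]
  simp only [hval, vectorFunctional_apply, mul_comm, ite_mul, zero_mul, Finset.sum_ite_eq,
    Finset.mem_univ, if_true]
  rfl

theorem exists_isOrthogonalMeasure {ω : Functional} (hω : ω ∈ stateSpace) :
    ∃ μ : MeasureTheory.Measure PureState, IsOrthogonalMeasure μ ω := by
  obtain ⟨a, e, h⟩ := exists_spectral_decomposition hω
  exact ⟨_, a, e, basisState e, fun i => isVectorState_iff.mpr rfl, h, rfl⟩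

theorem isPure_mem_stateSpace (p : PureState) : (p : Functional) ∈ stateSpace :=
  extremePoints_subset p.2

theorem sum_weights_eq_one {ω : Functional} (hω : ω ∈ stateSpace) {a : Fin 2 → ℝ≥0}
    {p : Fin 2 → Functional} (hp : ∀ i, p i ∈ stateSpace)
    (h : ∀ x : M₂, ω x = ∑ i, ((a i : ℝ) : ℂ) * p i x) : (a 0 : ℝ) + a 1 = 1 := by
  have := h 1
  rw [hω.2, Fin.sum_univ_two, (hp 0).2, (hp 1).2] at this
  exact_mod_cast (by simpa using this.symm : ((a 0 : ℝ) : ℂ) + ((a 1 : ℝ) : ℂ) = 1)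

theorem exists_basis_of_pureState (p : PureState) :
    ∃ e : OrthonormalBasis (Fin 2) ℂ Qubit, p = basisState e 0 := by
  obtain ⟨a, e, h⟩ := exists_spectral_decomposition (isPure_mem_stateSpace p)
  have hst : ∀ i, vectorFunctional (e i) ∈ stateSpace := fun i =>
    isPure_mem_stateSpace (basisState e i)
  have hsum := sum_weights_eq_one (isPure_mem_stateSpace p) hst h
  have hp : (p : Functional) = (a 0 : ℝ) • vectorFunctional (e 0) +
      (a 1 : ℝ) • vectorFunctional (e 1) := by
    refine DFunLike.ext _ _ fun x => ?_
    rw [h, Fin.sum_univ_two]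
    rfl
  rcases (a 0).2.eq_or_lt with h0 | h0
  · refine ⟨swapBasis e, Subtype.ext (DFunLike.ext _ _ fun x => ?_)⟩
    have h0' : (a 0 : ℝ) = 0 := h0.symm
    have h1 : (a 1 : ℝ) = 1 := by linarith
    rw [h, Fin.sum_univ_two, h0', h1]
    simp [basisState]
  · rcases (a 1).2.eq_or_lt with h1 | h1
    · refine ⟨e, Subtype.ext (DFunLike.ext _ _ fun x => ?_)⟩
      have h1' : (a 1 : ℝ) = 0 := h1.symm
      have h2 : (a 0 : ℝ) = 1 := by linarith
      rw [h, Fin.sum_univ_two, h1', h2]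
      simp [basisState]
    · refine ⟨e, Subtype.ext ?_⟩
      exact ((mem_extremePoints.mp p.2).2 _ (hst 0) _ (hst 1)
        ⟨a 0, a 1, h0, h1, hsum, hp.symm⟩).1.symm

/-! ### The Kadison–Schwarz inequality -/

theorem CStarAlgebra.exists_eq_star_mul_self {A : Type*} [CStarAlgebra A] [PartialOrder A]
    [StarOrderedRing A] {a : A} (ha : 0 ≤ a) : ∃ b, a = star b * b :=
  CStarAlgebra.nonneg_iff_eq_star_mul_self.mp ha

/-- Only 2-positivity matters: `star Y * Y` has entries `1, x, star x, star x * x`. Its image under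
`T` is a square `star Z * Z` with upper left entry `1`, and the claim is positivity of the Schur
complement of that entry. -/
theorem CompletelyPositiveMap.kadison_schwarz (T : M₂ →CP M₂) (hT : T 1 = 1) (x : M₂) :
    star (T x) * T x ≤ T (star x * x) := by
  let Y : CStarMatrix (Fin 2) (Fin 2) M₂ := CStarMatrix.ofMatrix !![1, x; 0, 0]
  have h := T.map_cstarMatrix_nonneg _ (star_mul_self_nonneg Y)
  obtain ⟨Z, hZ⟩ := CStarAlgebra.exists_eq_star_mul_self h
  have hN : ∀ i j, T ((star Y * Y) i j) = star (Z 0 i) * Z 0 j + star (Z 1 i) * Z 1 j := by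
    intro i j
    have := congrFun (congrFun hZ i) j
    simpa [CStarMatrix.mul_apply, CStarMatrix.star_apply, Fin.sum_univ_two] using this
  have h00 := hN 0 0
  have h01 := hN 0 1
  have h11 := hN 1 1
  simp [CStarMatrix.mul_apply, CStarMatrix.star_apply, Fin.sum_univ_two, Y,
    CStarMatrix.ofMatrix_apply, hT] at h00 h01 h11
  have h10 := congrArg star h01
  simp only [star_add, star_mul, star_star] at h10
  have key : T (star x * x) - star (T x) * T x =
      star (Z 0 1 - Z 0 0 * T x) * (Z 0 1 - Z 0 0 * T x) +
      star (Z 1 1 - Z 1 0 * T x) * (Z 1 1 - Z 1 0 * T x) := by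
    have e1 : star (Z 0 1 - Z 0 0 * T x) * (Z 0 1 - Z 0 0 * T x) +
      star (Z 1 1 - Z 1 0 * T x) * (Z 1 1 - Z 1 0 * T x) =
      (star (Z 0 1) * Z 0 1 + star (Z 1 1) * Z 1 1)
      - (star (Z 0 1) * Z 0 0 + star (Z 1 1) * Z 1 0) * T x
      - star (T x) * (star (Z 0 0) * Z 0 1 + star (Z 1 0) * Z 1 1)
      + star (T x) * (star (Z 0 0) * Z 0 0 + star (Z 1 0) * Z 1 0) * T x := by
      simp only [star_sub, star_mul]
      noncomm_ring
    rw [e1, ← h00, ← h10, ← h01, ← h11]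
    noncomm_ring
  rw [← sub_nonneg, key]
  exact add_nonneg (star_mul_self_nonneg _) (star_mul_self_nonneg _)

/-! ### Exponential functions on the half-line -/

/-- A zero of `f` would propagate to `t / 2 ^ n` and contradict `f 0 = 1`. The logarithm is then
continuous and additive, hence linear. -/
theorem exists_eq_exp_of_continuous_mul {f : ℝ≥0 → ℝ} (hc : Continuous f) (h0 : f 0 = 1)
    (hn : ∀ t, 0 ≤ f t) (hm : ∀ s t, f (s + t) = f s * f t) :
    ∃ a : ℝ, ∀ t : ℝ≥0, f t = Real.exp (-(a * t)) := by
  have hpos : ∀ t, 0 < f t := by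
    intro t
    by_contra hcon
    have hz : f t = 0 := le_antisymm (not_lt.mp hcon) (hn t)
    have hk : ∀ n : ℕ, f (t / 2 ^ n) = 0 := by
      intro n
      induction n with
      | zero => simpa using hz
      | succ n ih =>
        have h2 : t / 2 ^ n = t / 2 ^ (n + 1) + t / 2 ^ (n + 1) := by
          rw [pow_succ, ← div_div, add_halves]
        rw [h2, hm] at ih
        exact mul_self_eq_zero.mp ih
    have hl : Filter.Tendsto (fun n : ℕ => t / 2 ^ n) Filter.atTop (𝓝 0) := by
      rw [← NNReal.tendsto_coe]
      push_cast
      exact tendsto_const_nhds.div_atTop (tendsto_pow_atTop_atTop_of_one_lt one_lt_two)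
    have hl2 := (hc.tendsto 0).comp hl
    rw [h0] at hl2
    have : (f ∘ fun n : ℕ => t / 2 ^ n) = fun _ => 0 := funext hk
    rw [this] at hl2
    exact zero_ne_one (tendsto_nhds_unique tendsto_const_nhds hl2)
  let g : ℝ≥0 → ℝ := fun t => Real.log (f t)
  have hg : ∀ s t, g (s + t) = g s + g t := fun s t => by
    simp only [g, hm, Real.log_mul (hpos s).ne' (hpos t).ne']
  have hgc : Continuous g := hc.log fun t => (hpos t).ne'
  -- The odd extension of `g` to the line, where continuous additive maps are known to be linear.
  let F : ℝ →+ ℝ := AddMonoidHom.mk' (fun x => g x.toNNReal - g (-x).toNNReal) <| by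
    intro x y
    have key : (x + y).toNNReal + ((-x).toNNReal + (-y).toNNReal) =
        (-(x + y)).toNNReal + (x.toNNReal + y.toNNReal) := by
      apply NNReal.coe_injective
      simp only [NNReal.coe_add, Real.coe_toNNReal']
      have h : ∀ z : ℝ, max z 0 = z + max (-z) 0 := fun z => by
        rcases le_total z 0 with hz | hz
        · rw [max_eq_right hz, max_eq_left (by linarith)]; ring
        · rw [max_eq_left hz, max_eq_right (by linarith)]; ring
      linarith [h x, h y, h (x + y)]
    have := congrArg g key
    rw [hg, hg, hg, hg] at this
    linarith
  have hF : Continuous F :=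
    (hgc.comp continuous_real_toNNReal).sub (hgc.comp (continuous_real_toNNReal.comp continuous_neg))
  have hg0 : g 0 = 0 := by simp [g, h0]
  refine ⟨-F 1, fun t => ?_⟩
  have h1 : F t = g t := by
    change g (t : ℝ).toNNReal - g (-(t : ℝ)).toNNReal = _
    rw [Real.toNNReal_of_nonpos (by simp : -(t : ℝ) ≤ 0), hg0]
    simp
  have h2 : F t = t * F 1 := by
    have := (F.toRealLinearMap hF).map_smul (t : ℝ) 1
    simpa using this
  rw [← Real.exp_log (hpos t)]
  change Real.exp (g t) = _
  rw [← h1, h2]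
  ring_nf

/-! ### The dynamics around an invariant vector state -/

namespace QuantumMarkovSemigroup

variable (S : QuantumMarkovSemigroup)

theorem predual_apply (t : ℝ≥0) (ω : Functional) (x : M₂) :
    S.predual t ω x = ω (S.T t x) := rfl

theorem predual_mem_stateSpace (t : ℝ≥0) {ω : Functional} (hω : ω ∈ stateSpace) :
    S.predual t ω ∈ stateSpace :=
  ⟨fun x hx => hω.1 _ (map_nonneg (S.T t) hx), by rw [predual_apply, S.map_one, hω.2]⟩

theorem IsAbsorbing.tendsto_apply {S : QuantumMarkovSemigroup} {σ : Functional}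
    (h : S.IsAbsorbing σ) {ω : Functional} (hω : ω ∈ stateSpace) (x : M₂) :
    Filter.Tendsto (fun t => ω (S.T t x)) Filter.atTop (𝓝 (σ x)) :=
  ((WeakDual.eval_continuous x).tendsto σ).comp (h.2 ω hω)

/-- The orbit of `σ` and its shift by `t` have the same limit `σ`. -/
theorem IsAbsorbing.apply_eq {S : QuantumMarkovSemigroup} {σ : Functional} (h : S.IsAbsorbing σ)
    (t : ℝ≥0) (x : M₂) : σ (S.T t x) = σ x := by
  have h1 := h.tendsto_apply h.1 (S.T t x)
  have h2 := (h.tendsto_apply h.1 x).comp (Filter.tendsto_atTop_mono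
    (fun s : ℝ≥0 => (le_self_add : s ≤ s + t)) Filter.tendsto_id)
  refine tendsto_nhds_unique h1 (h2.congr fun s => ?_)
  rw [Function.comp_apply, S.map_add]

variable (e : OrthonormalBasis (Fin 2) ℂ Qubit)

/-- The diagonal coefficient of the semigroup on `|e₁⟩⟨e₁|`. -/
noncomputable def decay (t : ℝ≥0) : ℝ :=
  (matrixFunctional (e 1) (e 1) (S.T t (ketbra (e 1) (e 1)))).re

/-- The diagonal coefficient of the semigroup on `|e₀⟩⟨e₁|`. -/
noncomputable def coherence (t : ℝ≥0) : ℂ :=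
  matrixFunctional (e 0) (e 1) (S.T t (ketbra (e 0) (e 1)))

/-- The coefficient of `|e₁⟩⟨e₁|` in the evolution of `|e₀⟩⟨e₁|`. -/
noncomputable def leakage (t : ℝ≥0) : ℂ :=
  matrixFunctional (e 1) (e 1) (S.T t (ketbra (e 0) (e 1)))

theorem continuous_decay : Continuous (S.decay e) :=
  Complex.continuous_re.comp (S.weakStarContinuous _ _)

theorem continuous_coherence : Continuous (S.coherence e) :=
  S.weakStarContinuous _ _

theorem decay_zero : S.decay e 0 = 1 := by
  simp [decay, S.map_zero, matrixFunctional_ketbra]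

theorem coherence_zero : S.coherence e 0 = 1 := by
  simp [coherence, S.map_zero, matrixFunctional_ketbra]

theorem decay_nonneg (t : ℝ≥0) : 0 ≤ S.decay e t :=
  (inner_toEuclideanLin_nonneg (map_nonneg (S.T t) (ketbra_self_nonneg (e 1))) (e 1)).1

variable {S e}

theorem apply_eq_zero_of_inner_eq_zero {y : M₂} (hy : 0 ≤ y) {v : Qubit}
    (h : inner ℂ v (Matrix.toEuclideanLin y v) = 0) : Matrix.toEuclideanLin y v = 0 := by
  obtain ⟨b, rfl⟩ := CStarAlgebra.exists_eq_star_mul_self hy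
  rw [toEuclideanLin_mul, inner_toEuclideanLin_star, inner_self_eq_zero] at h
  rw [toEuclideanLin_mul, h, _root_.map_zero]

variable (h : S.IsAbsorbing (vectorFunctional (e 0)))
include h

/-- By invariance the positive operator on the left has zero expectation at `e 0`, so it kills `e
0`; self-adjointness then removes the last off-diagonal entry. -/
theorem map_ketbra_one_one (t : ℝ≥0) :
    S.T t (ketbra (e 1) (e 1)) = (S.decay e t : ℂ) • ketbra (e 1) (e 1) := by
  have hy := map_nonneg (S.T t) (ketbra_self_nonneg (e 1))
  have h0 : Matrix.toEuclideanLin (S.T t (ketbra (e 1) (e 1))) (e 0) = 0 := by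
    apply apply_eq_zero_of_inner_eq_zero hy
    rw [← vectorFunctional_apply, h.apply_eq, vectorFunctional_ketbra]
    simp [e.inner_eq_ite]
  have h01 : inner ℂ (e 0) (Matrix.toEuclideanLin (S.T t (ketbra (e 1) (e 1))) (e 1)) = 0 := by
    have hsa : star (S.T t (ketbra (e 1) (e 1))) = S.T t (ketbra (e 1) (e 1)) :=
      (IsSelfAdjoint.of_nonneg hy).star_eq
    rw [← hsa, inner_toEuclideanLin_star, h0, inner_zero_left]
  have h11 : inner ℂ (e 1) (Matrix.toEuclideanLin (S.T t (ketbra (e 1) (e 1))) (e 1)) =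
      (S.decay e t : ℂ) :=
    Complex.ext rfl (inner_toEuclideanLin_nonneg hy (e 1)).2.symm
  conv_lhs => rw [eq_sum_ketbra e (S.T t (ketbra (e 1) (e 1)))]
  simp only [Fin.sum_univ_two, h0, h01, h11, inner_zero_right, zero_smul, zero_add]

/-- This is Kadison–Schwarz at `x = |e₀⟩⟨e₁|`, for which `star x * x = |e₁⟩⟨e₁|`. Taking `v = e 0`
below yields the shape of the image, and `v = e 1` the bound on its two coefficients. -/
theorem norm_sq_map_ketbra_le (t : ℝ≥0) (v : Qubit) :
    ‖Matrix.toEuclideanLin (S.T t (ketbra (e 0) (e 1))) v‖ ^ 2 ≤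
      S.decay e t * ‖inner ℂ (e 1) v‖ ^ 2 := by
  have hks := (S.T t).kadison_schwarz (S.map_one t) (ketbra (e 0) (e 1))
  rw [star_ketbra, ketbra_mul_ketbra, e.inner_eq_one, one_smul, map_ketbra_one_one h] at hks
  have h2 := (inner_toEuclideanLin_nonneg (sub_nonneg.mpr hks) v).1
  rw [map_sub, LinearMap.sub_apply, inner_sub_right, toEuclideanLin_mul,
    inner_toEuclideanLin_star, map_smul, LinearMap.smul_apply, toEuclideanLin_ketbra,
    inner_smul_right, inner_smul_right, inner_self_eq_norm_sq_to_K, ← inner_conj_symm v (e 1),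
    Complex.mul_conj, Complex.normSq_eq_norm_sq] at h2
  norm_cast at h2
  exact sub_nonneg.mp h2

theorem map_ketbra_zero_one (t : ℝ≥0) :
    S.T t (ketbra (e 0) (e 1)) =
      S.coherence e t • ketbra (e 0) (e 1) + S.leakage e t • ketbra (e 1) (e 1) := by
  have h0 : Matrix.toEuclideanLin (S.T t (ketbra (e 0) (e 1))) (e 0) = 0 := by
    have := norm_sq_map_ketbra_le h t (e 0)
    rw [e.inner_eq_zero (by decide), norm_zero, zero_pow two_ne_zero, mul_zero] at this
    simpa using le_antisymm this (by positivity)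
  conv_lhs => rw [eq_sum_ketbra e (S.T t (ketbra (e 0) (e 1)))]
  simp only [Fin.sum_univ_two, h0, inner_zero_right, zero_smul, zero_add]
  rfl

theorem coherence_sq_add_leakage_sq_le (t : ℝ≥0) :
    ‖S.coherence e t‖ ^ 2 + ‖S.leakage e t‖ ^ 2 ≤ S.decay e t := by
  have h1 := norm_sq_map_ketbra_le h t (e 1)
  rw [← e.sum_sq_norm_inner_right, Fin.sum_univ_two, e.inner_eq_one, norm_one, one_pow,
    mul_one] at h1
  exact h1

theorem decay_add (s t : ℝ≥0) : S.decay e (s + t) = S.decay e s * S.decay e t := by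
  rw [decay, S.map_add, map_ketbra_one_one h t, map_smul, map_ketbra_one_one h s, map_smul,
    map_smul, matrixFunctional_ketbra]
  simp [mul_comm]

theorem coherence_add (s t : ℝ≥0) :
    S.coherence e (s + t) = S.coherence e s * S.coherence e t := by
  rw [coherence, S.map_add, map_ketbra_zero_one h t, _root_.map_add, map_smul, map_smul,
    map_ketbra_one_one h s, map_ketbra_zero_one h s]
  simp only [_root_.map_add, map_smul, matrixFunctional_ketbra, smul_eq_mul, e.inner_eq_ite]
  simp [mul_comm]

theorem leakage_add (s t : ℝ≥0) :
    S.leakage e (s + t) = S.coherence e t * S.leakage e s + S.leakage e t * S.decay e s := by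
  rw [leakage, S.map_add, map_ketbra_zero_one h t, _root_.map_add, map_smul, map_smul,
    map_ketbra_one_one h s, map_ketbra_zero_one h s]
  simp only [_root_.map_add, map_smul, matrixFunctional_ketbra, smul_eq_mul, e.inner_eq_ite]
  simp

theorem tendsto_decay : Filter.Tendsto (S.decay e) Filter.atTop (𝓝 0) := by
  have h1 := h.tendsto_apply (vectorFunctional_mem_stateSpace (e.orthonormal.1 1))
    (ketbra (e 1) (e 1))
  rw [vectorFunctional_ketbra, e.inner_eq_zero (by decide), zero_mul] at h1
  exact (Complex.continuous_re.tendsto 0).comp h1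

theorem exists_decay_eq_exp : ∃ a > 0, ∀ t : ℝ≥0, S.decay e t = Real.exp (-(a * t)) := by
  obtain ⟨a, ha⟩ := exists_eq_exp_of_continuous_mul (S.continuous_decay e) (S.decay_zero e)
    (S.decay_nonneg e) (decay_add h)
  refine ⟨a, ?_, ha⟩
  by_contra hcon
  have h1 : ∀ t, 1 ≤ S.decay e t := fun t => by
    rw [ha]
    exact Real.one_le_exp (by nlinarith [t.2, not_lt.mp hcon, NNReal.coe_nonneg t])
  exact absurd (ge_of_tendsto' (tendsto_decay h) h1) (by norm_num)

theorem decay_pos (t : ℝ≥0) : 0 < S.decay e t := by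
  obtain ⟨a, -, ha⟩ := exists_decay_eq_exp h
  rw [ha]
  exact Real.exp_pos _

/-- Either the coherence decays strictly faster than the square root of the population, or there
is no leakage at all. -/
theorem coherence_dichotomy :
    Filter.Tendsto (fun t => ‖S.coherence e t‖ ^ 2 / S.decay e t) Filter.atTop (𝓝 0) ∨
      ∀ t, ‖S.coherence e t‖ ^ 2 = S.decay e t ∧ S.leakage e t = 0 := by
  obtain ⟨a, -, ha⟩ := exists_decay_eq_exp h
  obtain ⟨b, hb⟩ := exists_eq_exp_of_continuous_mul (f := fun t => ‖S.coherence e t‖ ^ 2)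
    ((S.continuous_coherence e).norm.pow 2) (by simp [coherence_zero])
    (fun t => by positivity) (fun s t => by simp only [coherence_add h, norm_mul, mul_pow])
  have hle := fun t => coherence_sq_add_leakage_sq_le h t
  have hab : a ≤ b := by
    have h1 := hle 1
    have h2 : ‖S.coherence e 1‖ ^ 2 = _ := hb 1
    rw [h2, ha] at h1
    have h3 : Real.exp (-(b * (1 : ℝ≥0))) ≤ Real.exp (-(a * (1 : ℝ≥0))) := by
      linarith [sq_nonneg ‖S.leakage e 1‖]
    simpa using h3
  -- Equal exponents saturate `coherence_sq_add_leakage_sq_le`, which leaves no room for leakage.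
  rcases hab.eq_or_lt with rfl | hlt
  · refine Or.inr fun t => ?_
    have heq : ‖S.coherence e t‖ ^ 2 = S.decay e t := by rw [ha]; exact hb t
    refine ⟨heq, ?_⟩
    have h1 := hle t
    rw [heq] at h1
    have h2 : ‖S.leakage e t‖ ^ 2 = 0 := le_antisymm (by linarith) (by positivity)
    simpa using h2
  · left
    have h1 : (fun t => ‖S.coherence e t‖ ^ 2 / S.decay e t) =
        fun t : ℝ≥0 => Real.exp (-((b - a) * t)) := by
      funext t
      rw [ha, show ‖S.coherence e t‖ ^ 2 = _ from hb t, ← Real.exp_sub]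
      ring_nf
    rw [h1]
    refine Real.tendsto_exp_neg_atTop_nhds_zero.comp ?_
    exact (NNReal.tendsto_coe_atTop.mpr Filter.tendsto_id).const_mul_atTop (sub_pos.mpr hlt)

/-- At equal times the cocycle relation `leakage_add` factors as `leakage * (coherence + decay)`,
while `decay (t + t)` is a square; one factor `decay` cancels against `|leakage|² ≤ decay`. -/
theorem leakage_sq_div_le (t : ℝ≥0) :
    ‖S.leakage e (t + t)‖ ^ 2 / S.decay e (t + t) ≤
      2 * (‖S.coherence e t‖ ^ 2 / S.decay e t) + 2 * S.decay e t := by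
  have hc := decay_pos h t
  have hl : ‖S.leakage e t‖ ^ 2 ≤ S.decay e t := by
    linarith [coherence_sq_add_leakage_sq_le h t, sq_nonneg ‖S.coherence e t‖]
  have hn : ‖S.coherence e t + S.decay e t‖ ≤ ‖S.coherence e t‖ + S.decay e t := by
    refine (norm_add_le _ _).trans ?_
    simp [abs_of_pos hc]
  have hn2 : ‖S.coherence e t + S.decay e t‖ ^ 2 ≤
      2 * ‖S.coherence e t‖ ^ 2 + 2 * S.decay e t ^ 2 := by
    refine (pow_le_pow_left₀ (norm_nonneg _) hn 2).trans ?_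
    linarith [sq_nonneg (‖S.coherence e t‖ - S.decay e t)]
  rw [leakage_add h, decay_add h, show S.coherence e t * S.leakage e t +
    S.leakage e t * S.decay e t = S.leakage e t * (S.coherence e t + S.decay e t) by ring,
    norm_mul, mul_pow, div_le_iff₀ (by positivity)]
  refine (mul_le_mul hl hn2 (by positivity) hc.le).trans (le_of_eq ?_)
  field_simp

theorem tendsto_leakage (hcoh : Filter.Tendsto (fun t => ‖S.coherence e t‖ ^ 2 / S.decay e t)
    Filter.atTop (𝓝 0)) :
    Filter.Tendsto (fun t => ‖S.leakage e t‖ ^ 2 / S.decay e t) Filter.atTop (𝓝 0) := by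
  have h1 : Filter.Tendsto (fun t => 2 * (‖S.coherence e t‖ ^ 2 / S.decay e t) + 2 * S.decay e t)
      Filter.atTop (𝓝 0) := by
    simpa using (hcoh.const_mul 2).add ((tendsto_decay h).const_mul 2)
  have hhalf : Filter.Tendsto (fun t : ℝ≥0 => t / 2) Filter.atTop Filter.atTop :=
    Filter.tendsto_id.atTop_div_const (by norm_num)
  refine squeeze_zero (fun t => div_nonneg (by positivity) (S.decay_nonneg e t)) (fun t => ?_)
    (h1.comp hhalf)
  have := leakage_sq_div_le h (t / 2)
  rwa [add_halves] at this

end QuantumMarkovSemigroup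

/-! ### The determinant of a density matrix -/

/-- The determinant of the density matrix of `ω`, computed in the basis `e`. -/
noncomputable def stateDet (e : OrthonormalBasis (Fin 2) ℂ Qubit) (ω : Functional) : ℝ :=
  (ω (ketbra (e 0) (e 0))).re * (ω (ketbra (e 1) (e 1))).re - ‖ω (ketbra (e 0) (e 1))‖ ^ 2

theorem stateDet_le {ω : Functional} (hω : ω ∈ stateSpace)
    (e : OrthonormalBasis (Fin 2) ℂ Qubit) :
    stateDet e ω ≤ (ω (ketbra (e 1) (e 1))).re := by
  have h0 := state_ketbra_re_nonneg hω (e 0)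
  have h1 := state_ketbra_re_nonneg hω (e 1)
  have h2 := state_ketbra_re_add hω e
  rw [stateDet]
  nlinarith [sq_nonneg ‖ω (ketbra (e 0) (e 1))‖]

/-- The determinant does not depend on the basis: the change of basis from `e` to `f` contributes
the squared modulus of a unitary determinant. -/
theorem stateDet_eq_mul {ω : Functional} (hω : ω ∈ stateSpace) {a : Fin 2 → ℝ≥0}
    (e f : OrthonormalBasis (Fin 2) ℂ Qubit)
    (h : ∀ x : M₂, ω x = ∑ i, ((a i : ℝ) : ℂ) * vectorFunctional (f i) x) :
    stateDet e ω = a 0 * a 1 := by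
  have hs : ∀ i j, inner ℂ (f i) (f j) = inner ℂ (f i) (e 0) * inner ℂ (e 0) (f j) +
      inner ℂ (f i) (e 1) * inner ℂ (e 1) (f j) := fun i j => by
    rw [← e.sum_inner_mul_inner, Fin.sum_univ_two]
  have h00 := hs 0 0
  have h01 := hs 0 1
  have h10 := hs 1 0
  have h11 := hs 1 1
  rw [f.inner_eq_one] at h00 h11
  rw [f.inner_eq_zero (by decide)] at h01 h10
  have hdet : ((stateDet e ω : ℝ) : ℂ) = ω (ketbra (e 0) (e 0)) * ω (ketbra (e 1) (e 1)) -
      ω (ketbra (e 0) (e 1)) * ω (ketbra (e 1) (e 0)) := by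
    rw [state_ketbra_swap hω (e 0) (e 1), Complex.star_def, Complex.mul_conj,
      Complex.normSq_eq_norm_sq, state_ketbra_eq_re hω (e 0), state_ketbra_eq_re hω (e 1),
      stateDet]
    push_cast
    rfl
  have hcast : ((stateDet e ω : ℝ) : ℂ) = ((a 0 : ℝ) : ℂ) * ((a 1 : ℝ) : ℂ) := by
    rw [hdet]
    simp only [h, Fin.sum_univ_two, vectorFunctional_ketbra]
    generalize inner ℂ (f 0) (e 0) = u at *
    generalize inner ℂ (f 0) (e 1) = v at *
    generalize inner ℂ (f 1) (e 0) = w at *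
    generalize inner ℂ (f 1) (e 1) = z at *
    generalize inner ℂ (e 0) (f 0) = u' at *
    generalize inner ℂ (e 1) (f 0) = v' at *
    generalize inner ℂ (e 0) (f 1) = w' at *
    generalize inner ℂ (e 1) (f 1) = z' at *
    -- The coefficients encode the Gram determinant identity `1 * 1 - 0 * 0 = |det|²` for the
    -- transition matrix.
    linear_combination ((a 0 : ℝ) : ℂ) * ((a 1 : ℝ) : ℂ) *
      (-(w * w' + z * z') * h00 - h11 + (w * u' + z * v') * h01)
  exact_mod_cast hcast

/-! ### Lower bound for the determinant along the evolution. -/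

namespace QuantumMarkovSemigroup

variable {S : QuantumMarkovSemigroup} {e : OrthonormalBasis (Fin 2) ℂ Qubit}

section

variable (h : S.IsAbsorbing (vectorFunctional (e 0)))
include h

theorem predual_ketbra_one_re (t : ℝ≥0) (ω : Functional) :
    (S.predual t ω (ketbra (e 1) (e 1))).re = S.decay e t * (ω (ketbra (e 1) (e 1))).re := by
  rw [predual_apply, map_ketbra_one_one h, map_smul, smul_eq_mul, Complex.re_ofReal_mul]

theorem predual_ketbra_zero_one (t : ℝ≥0) (ω : Functional) :
    S.predual t ω (ketbra (e 0) (e 1)) =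
      S.coherence e t * ω (ketbra (e 0) (e 1)) + S.leakage e t * ω (ketbra (e 1) (e 1)) := by
  rw [predual_apply, map_ketbra_zero_one h, _root_.map_add, map_smul, map_smul, smul_eq_mul,
    smul_eq_mul]

theorem stateDet_predual {ω : Functional} (hω : ω ∈ stateSpace) (t : ℝ≥0) :
    stateDet e (S.predual t ω) =
      (1 - S.decay e t * (ω (ketbra (e 1) (e 1))).re) *
        (S.decay e t * (ω (ketbra (e 1) (e 1))).re) -
      ‖S.coherence e t * ω (ketbra (e 0) (e 1)) + S.leakage e t * ω (ketbra (e 1) (e 1))‖ ^ 2 := by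
  have h2 := state_ketbra_re_add (S.predual_mem_stateSpace t hω) e
  rw [stateDet, ← predual_ketbra_zero_one h, ← predual_ketbra_one_re h, ← h2]
  ring

theorem eventually_le_stateDet {ω : Functional} (hω : ω ∈ stateSpace)
    (hne : ω ≠ vectorFunctional (e 0)) :
    ∃ κ > 0, ∀ᶠ t in Filter.atTop, κ * S.decay e t ≤ stateDet e (S.predual t ω) := by
  set x := (ω (ketbra (e 1) (e 1))).re with hx
  have hx0 : 0 < x := (state_ketbra_re_nonneg hω (e 1)).lt_of_ne
    fun h0 => hne (eq_vectorFunctional hω e h0.symm)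
  have hoff := state_ketbra_offDiag hω e
  have hadd := state_ketbra_re_add hω e
  rw [← hx] at hoff hadd
  have hxe : ω (ketbra (e 1) (e 1)) = (x : ℂ) := state_ketbra_eq_re hω (e 1)
  rcases coherence_dichotomy h with hc | hc
  · have hl := tendsto_leakage h hc
    have hlim : Filter.Tendsto (fun t => x * (1 - S.decay e t * x) -
        2 * ((‖S.coherence e t‖ ^ 2 / S.decay e t) * ‖ω (ketbra (e 0) (e 1))‖ ^ 2) -
        2 * ((‖S.leakage e t‖ ^ 2 / S.decay e t) * x ^ 2)) Filter.atTop (𝓝 x) := by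
      have := (((tendsto_const_nhds (x := (1 : ℝ))).sub
        ((tendsto_decay h).mul_const x)).const_mul x).sub
        ((hc.mul_const (‖ω (ketbra (e 0) (e 1))‖ ^ 2)).const_mul 2) |>.sub
        ((hl.mul_const (x ^ 2)).const_mul 2)
      simpa using this
    -- The expression in `hlim`, times `decay`, is a lower bound for the determinant; it tends to
    -- `x`, so half of `x` is safe.
    refine ⟨x / 2, half_pos hx0, ?_⟩
    filter_upwards [hlim.eventually_const_le (half_lt_self hx0)] with t ht
    have hd := decay_pos h t
    rw [stateDet_predual h hω, ← hx, hxe]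
    have hn : ‖S.coherence e t * ω (ketbra (e 0) (e 1)) + S.leakage e t * (x : ℂ)‖ ^ 2 ≤
        2 * (‖S.coherence e t‖ ^ 2 * ‖ω (ketbra (e 0) (e 1))‖ ^ 2) +
        2 * (‖S.leakage e t‖ ^ 2 * x ^ 2) := by
      refine (pow_le_pow_left₀ (norm_nonneg _) (norm_add_le _ _) 2).trans ?_
      rw [norm_mul, norm_mul, Complex.norm_real, Real.norm_of_nonneg hx0.le]
      linarith [sq_nonneg (‖S.coherence e t‖ * ‖ω (ketbra (e 0) (e 1))‖ - ‖S.leakage e t‖ * x)]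
    have ht2 := mul_le_mul_of_nonneg_right ht hd.le
    have heq : (x * (1 - S.decay e t * x) -
        2 * ((‖S.coherence e t‖ ^ 2 / S.decay e t) * ‖ω (ketbra (e 0) (e 1))‖ ^ 2) -
        2 * ((‖S.leakage e t‖ ^ 2 / S.decay e t) * x ^ 2)) * S.decay e t =
        (1 - S.decay e t * x) * (S.decay e t * x) -
        (2 * (‖S.coherence e t‖ ^ 2 * ‖ω (ketbra (e 0) (e 1))‖ ^ 2) +
        2 * (‖S.leakage e t‖ ^ 2 * x ^ 2)) := by
      field_simp
      ring
    linarith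
  -- Here the squared off-diagonal entry is at most `decay * (1 - x) * x`, so the determinant is at
  -- least `decay * x ^ 2 * (1 - decay)`.
  · refine ⟨x ^ 2 / 2, by positivity, ?_⟩
    filter_upwards [(tendsto_decay h).eventually_le_const (show (0 : ℝ) < 1 / 2 by norm_num)]
      with t ht
    have hd := decay_pos h t
    rw [stateDet_predual h hω, ← hx, (hc t).2, zero_mul, add_zero, norm_mul, mul_pow, (hc t).1]
    have h00 : (ω (ketbra (e 0) (e 0))).re = 1 - x := by linarith
    rw [h00] at hoff
    have h1 := mul_le_mul_of_nonneg_left hoff hd.le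
    have h2 : 0 ≤ S.decay e t * x ^ 2 * (1 / 2 - S.decay e t) := by
      have : 0 ≤ 1 / 2 - S.decay e t := by linarith
      positivity
    linarith

end

end QuantumMarkovSemigroup

/-! ### Convergence to a vector state -/

theorem tendsto_functional_iff {ι : Type*} {l : Filter ι} {ω : ι → Functional} {σ : Functional} :
    Filter.Tendsto ω l (𝓝 σ) ↔ ∀ x, Filter.Tendsto (fun i => ω i x) l (𝓝 (σ x)) :=
  tendsto_iff_forall_eval_tendsto_topDualPairing

/-- One population controls all entries: the other is its complement, and the off-diagonal ones are
bounded by its square root. -/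
theorem tendsto_vectorFunctional {ι : Type*} {l : Filter ι} {ω : ι → Functional}
    (hω : ∀ i, ω i ∈ stateSpace) (e : OrthonormalBasis (Fin 2) ℂ Qubit)
    (h : Filter.Tendsto (fun i => (ω i (ketbra (e 1) (e 1))).re) l (𝓝 0)) :
    Filter.Tendsto ω l (𝓝 (vectorFunctional (e 0))) := by
  have h11 : Filter.Tendsto (fun i => ω i (ketbra (e 1) (e 1))) l (𝓝 0) := by
    have := (Complex.continuous_ofReal.tendsto 0).comp h
    rw [Complex.ofReal_zero] at this
    exact this.congr fun i => (state_ketbra_eq_re (hω i) (e 1)).symm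
  have h00 : Filter.Tendsto (fun i => ω i (ketbra (e 0) (e 0))) l (𝓝 1) := by
    have := (tendsto_const_nhds (x := (1 : ℂ))).sub h11
    rw [sub_zero] at this
    refine this.congr fun i => ?_
    rw [← (hω i).2, ← sum_ketbra_self e, map_add, add_sub_cancel_right]
  have h01 : Filter.Tendsto (fun i => ω i (ketbra (e 0) (e 1))) l (𝓝 0) := by
    rw [tendsto_zero_iff_norm_tendsto_zero]
    have hsq : Filter.Tendsto (fun i => √((ω i (ketbra (e 1) (e 1))).re)) l (𝓝 0) := by
      simpa using h.sqrt
    refine squeeze_zero (fun _ => norm_nonneg _) (fun i => Real.le_sqrt_of_sq_le ?_) hsq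
    have h0 := state_ketbra_re_add (hω i) e
    have h1 := state_ketbra_re_nonneg (hω i) (e 1)
    nlinarith [state_ketbra_offDiag (hω i) e]
  have h10 : Filter.Tendsto (fun i => ω i (ketbra (e 1) (e 0))) l (𝓝 0) := by
    have := h01.star
    rw [star_zero] at this
    exact this.congr fun i => (state_ketbra_swap (hω i) _ _).symm
  refine tendsto_functional_iff.mpr fun x => ?_
  simp only [map_eq_sum_ketbra e (ω _) x, Fin.sum_univ_two]
  have := ((h00.const_mul (inner ℂ (e 0) (Matrix.toEuclideanLin x (e 0)))).add
    (h01.const_mul (inner ℂ (e 0) (Matrix.toEuclideanLin x (e 1))))).add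
    ((h10.const_mul (inner ℂ (e 1) (Matrix.toEuclideanLin x (e 0)))).add
    (h11.const_mul (inner ℂ (e 1) (Matrix.toEuclideanLin x (e 1)))))
  simpa [vectorFunctional_apply] using this

theorem tendsto_basisState {ι : Type*} {l : Filter ι} {q : ι → PureState}
    (e : OrthonormalBasis (Fin 2) ℂ Qubit)
    (h : Filter.Tendsto (fun i => ((q i : Functional) (ketbra (e 1) (e 1))).re) l (𝓝 0)) :
    Filter.Tendsto q l (𝓝 (basisState e 0)) :=
  tendsto_subtype_rng.mpr (tendsto_vectorFunctional (fun i => isPure_mem_stateSpace (q i)) e h)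

theorem basisState_swapBasis_zero (e : OrthonormalBasis (Fin 2) ℂ Qubit) :
    basisState (swapBasis e) 0 = basisState e 1 :=
  Subtype.ext (by simp [basisState])

theorem basisState_ne (e : OrthonormalBasis (Fin 2) ℂ Qubit) :
    basisState e 0 ≠ basisState e 1 := by
  intro h
  have := congrArg (fun p : PureState => (p : Functional) (ketbra (e 0) (e 0))) h
  simp [basisState, vectorFunctional_ketbra] at this

/-! ### Large deviations for two-point measures -/

open Classical in
/-- The rate function that is `0` at `x`, `a` at `y`, and infinite elsewhere. -/
noncomputable def twoPointRate {X : Type*} (x y : X) (a : ℝ) : X → ℝ≥0∞ :=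
  fun z => if z = x then 0 else if z = y then ENNReal.ofReal a else ⊤

theorem twoPointRate_eq_zero_iff {X : Type*} {x y : X} {a : ℝ} (ha : 0 < a) (z : X) :
    twoPointRate x y a z = 0 ↔ z = x := by
  unfold twoPointRate
  split_ifs <;> simp_all

theorem exp_neg_twoPointRate_left {X : Type*} (x y : X) (a : ℝ) :
    EReal.exp (-(twoPointRate x y a x : EReal)) = 1 := by
  simp [twoPointRate]

theorem exp_neg_twoPointRate_right {X : Type*} {x y : X} (hxy : x ≠ y) {a : ℝ} (ha : 0 < a) :
    EReal.exp (-(twoPointRate x y a y : EReal)) = ENNReal.ofReal (Real.exp (-a)) := by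
  rw [twoPointRate, if_neg hxy.symm, if_pos rfl, EReal.coe_ennreal_ofReal, max_eq_left ha.le,
    ← EReal.coe_neg, EReal.exp_coe]

theorem exp_neg_twoPointRate_of_ne {X : Type*} {x y z : X} (hx : z ≠ x) (hy : z ≠ y) (a : ℝ) :
    EReal.exp (-(twoPointRate x y a z : EReal)) = 0 := by
  rw [twoPointRate, if_neg hx, if_neg hy]
  simp

theorem lowerSemicontinuous_twoPointRate {X : Type*} [TopologicalSpace X] [T1Space X] (x y : X)
    (a : ℝ) : LowerSemicontinuous (twoPointRate x y a) := by
  rw [lowerSemicontinuous_iff_isClosed_preimage]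
  intro b
  rcases eq_or_ne b ⊤ with rfl | hb
  · simp
  · refine (Set.Finite.subset (Set.toFinite {x, y}) fun z hz => ?_).isClosed
    by_contra hcon
    rw [Set.mem_insert_iff, Set.mem_singleton_iff, not_or] at hcon
    rw [Set.mem_preimage, twoPointRate, if_neg hcon.1, if_neg hcon.2] at hz
    exact hb (top_le_iff.mp hz)

/-- The atoms converge, so a set matters only through which of `x` and `y` it contains; if it
contains `x`, the heavy atom decides. -/
theorem satisfiesLDP_twoPointRate {X : Type*} [TopologicalSpace X] [T1Space X]
    [MeasurableSpace X] [BorelSpace X] {μ : ℝ≥0 → MeasureTheory.Measure X} {s r : ℝ≥0 → ℝ≥0}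
    {q q' : ℝ≥0 → X} {x y : X} {a : ℝ} (hxy : x ≠ y) (ha : 0 < a)
    (hμ : ∀ t, μ t = s t • MeasureTheory.Measure.dirac (q t) +
      r t • MeasureTheory.Measure.dirac (q' t))
    (hsr : ∀ t, s t + r t = 1)
    (hq : Filter.Tendsto q Filter.atTop (𝓝 y)) (hq' : Filter.Tendsto q' Filter.atTop (𝓝 x))
    (hs : Filter.Tendsto (fun t => (s t : ℝ≥0∞) ^ (1 / (t : ℝ))) Filter.atTop
      (𝓝 (ENNReal.ofReal (Real.exp (-a)))))
    (hr : Filter.Tendsto (fun t => (r t : ℝ≥0∞) ^ (1 / (t : ℝ))) Filter.atTop (𝓝 1)) :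
    SatisfiesLDP μ (twoPointRate x y a) := by
  have happ : ∀ t (A : Set X), MeasurableSet A →
      μ t A = s t * A.indicator 1 (q t) + r t * A.indicator 1 (q' t) := by
    intro t A hA
    rw [hμ, MeasureTheory.Measure.add_apply, MeasureTheory.Measure.smul_apply,
      MeasureTheory.Measure.smul_apply, MeasureTheory.Measure.dirac_apply' _ hA,
      MeasureTheory.Measure.dirac_apply' _ hA]
    rfl
  have hexp : ∀ t : ℝ≥0, 0 ≤ 1 / (t : ℝ) := fun t => by positivity
  refine ⟨lowerSemicontinuous_twoPointRate x y a, fun F hF => ?_, fun G hG => ?_⟩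
  · by_cases hx : x ∈ F
    · have h1 : (1 : ℝ≥0∞) ≤ ⨆ z ∈ F, EReal.exp (-(twoPointRate x y a z : EReal)) :=
        (exp_neg_twoPointRate_left x y a).symm.le.trans
          (le_iSup₂ (f := fun z (_ : z ∈ F) => EReal.exp (-(twoPointRate x y a z : EReal))) x hx)
      refine le_trans (Filter.limsup_le_of_le (h := Filter.Eventually.of_forall fun t => ?_)) h1
      refine ENNReal.rpow_le_one ?_ (hexp t)
      rw [happ t F hF.measurableSet]
      have h2 : ∀ z, F.indicator (1 : X → ℝ≥0∞) z ≤ 1 := fun z => Set.indicator_le_self' (by simp) z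
      calc _ ≤ (s t : ℝ≥0∞) * 1 + r t * 1 := by gcongr <;> exact h2 _
        _ = 1 := by rw [mul_one, mul_one]; exact_mod_cast hsr t
    · have hx' := hq'.eventually (hF.isOpen_compl.mem_nhds hx)
      by_cases hy : y ∈ F
      · refine le_trans ?_
          (le_iSup₂ (f := fun z (_ : z ∈ F) => EReal.exp (-(twoPointRate x y a z : EReal))) y hy)
        rw [exp_neg_twoPointRate_right hxy ha, ← hs.limsup_eq]
        refine Filter.limsup_le_limsup ?_
        filter_upwards [hx'] with t ht
        refine ENNReal.rpow_le_rpow ?_ (hexp t)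
        rw [happ t F hF.measurableSet, Set.indicator_of_notMem ht, mul_zero, add_zero]
        exact mul_le_of_le_one_right' (Set.indicator_le_self' (by simp) _)
      · have hy' := hq.eventually (hF.isOpen_compl.mem_nhds hy)
        refine (Filter.limsup_le_of_le (h := ?_)).trans zero_le
        -- Time `0` must be avoided: there `1 / t` is `0` and `0 ^ 0 = 1`.
        filter_upwards [hx', hy', Filter.eventually_gt_atTop 0] with t ht ht' hpos
        rw [happ t F hF.measurableSet, Set.indicator_of_notMem ht, Set.indicator_of_notMem ht',
          mul_zero, mul_zero, add_zero, ENNReal.zero_rpow_of_pos (by positivity)]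
  · refine iSup₂_le fun z hz => ?_
    rcases eq_or_ne z x with rfl | hzx
    · rw [exp_neg_twoPointRate_left, ← hr.liminf_eq]
      refine Filter.liminf_le_liminf ?_
      filter_upwards [hq'.eventually (hG.mem_nhds hz)] with t ht
      refine ENNReal.rpow_le_rpow ?_ (hexp t)
      rw [happ t G hG.measurableSet, Set.indicator_of_mem ht, Pi.one_apply, mul_one]
      exact le_add_self
    · rcases eq_or_ne z y with rfl | hzy
      · rw [exp_neg_twoPointRate_right hxy ha, ← hs.liminf_eq]
        refine Filter.liminf_le_liminf ?_
        filter_upwards [hq.eventually (hG.mem_nhds hz)] with t ht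
        refine ENNReal.rpow_le_rpow ?_ (hexp t)
        rw [happ t G hG.measurableSet, Set.indicator_of_mem ht, Pi.one_apply, mul_one]
        exact le_self_add
      · rw [exp_neg_twoPointRate_of_ne hzx hzy]
        exact zero_le

/-- Constants disappear because `c ^ (1 / t)` tends to `1` for `c > 0`. -/
theorem tendsto_rpow_one_div {f : ℝ≥0 → ℝ≥0} {a κ K : ℝ} (hκ : 0 < κ)
    (hl : ∀ᶠ t : ℝ≥0 in Filter.atTop, κ * Real.exp (-(a * t)) ≤ f t)
    (hu : ∀ᶠ t : ℝ≥0 in Filter.atTop, f t ≤ K * Real.exp (-(a * t))) :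
    Filter.Tendsto (fun t : ℝ≥0 => (f t : ℝ≥0∞) ^ (1 / (t : ℝ))) Filter.atTop
      (𝓝 (ENNReal.ofReal (Real.exp (-a)))) := by
  have hK : 0 < K := by
    obtain ⟨t, h1, h2⟩ := (hl.and hu).exists
    exact hκ.trans_le (le_of_mul_le_mul_right (h1.trans h2) (Real.exp_pos _))
  have hinv : Filter.Tendsto (fun t : ℝ≥0 => 1 / (t : ℝ)) Filter.atTop (𝓝 0) :=
    tendsto_const_nhds.div_atTop (NNReal.tendsto_coe_atTop.mpr Filter.tendsto_id)
  have hc : ∀ c : ℝ, 0 < c → Filter.Tendsto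
      (fun t : ℝ≥0 => (c * Real.exp (-(a * t))) ^ (1 / (t : ℝ))) Filter.atTop
      (𝓝 (Real.exp (-a))) := by
    intro c hc
    have h1 : Filter.Tendsto (fun t : ℝ≥0 => c ^ (1 / (t : ℝ)) * Real.exp (-a)) Filter.atTop
        (𝓝 (Real.exp (-a))) := by
      have := ((Real.continuous_const_rpow hc.ne').tendsto 0).comp hinv
      simpa using this.mul_const (Real.exp (-a))
    refine h1.congr' ?_
    filter_upwards [Filter.eventually_gt_atTop 0] with t ht
    have ht' : (t : ℝ) ≠ 0 := by exact_mod_cast ht.ne'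
    rw [Real.mul_rpow hc.le (Real.exp_pos _).le, ← Real.exp_mul]
    congr 2
    field_simp
  have hreal : Filter.Tendsto (fun t : ℝ≥0 => (f t : ℝ) ^ (1 / (t : ℝ))) Filter.atTop
      (𝓝 (Real.exp (-a))) := by
    refine tendsto_of_tendsto_of_tendsto_of_le_of_le' (hc κ hκ) (hc K hK) ?_ ?_
    · filter_upwards [hl] with t ht
      exact Real.rpow_le_rpow (by positivity) ht (by positivity)
    · filter_upwards [hu] with t ht
      exact Real.rpow_le_rpow (by positivity) ht (by positivity)
  refine (ENNReal.tendsto_ofReal hreal).congr fun t => ?_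
  rw [← ENNReal.ofReal_rpow_of_nonneg (f t).coe_nonneg (by positivity), ENNReal.ofReal_coe_nnreal]

/-! ### From an absorbing pure state to the large deviation principle -/

/-- Parseval for `e k` in the basis `f`. It lets convergence of one eigenstate determine that of the
other. -/
theorem sum_vectorFunctional_ketbra (e f : OrthonormalBasis (Fin 2) ℂ Qubit) (k : Fin 2) :
    (vectorFunctional (f 0) (ketbra (e k) (e k))).re +
      (vectorFunctional (f 1) (ketbra (e k) (e k))).re = 1 := by
  have h := f.sum_sq_norm_inner_right (e k)
  rw [Fin.sum_univ_two, e.norm_eq_one, one_pow] at h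
  rw [← h, vectorFunctional_ketbra, vectorFunctional_ketbra,
    ← inner_conj_symm (e k) (f 0), ← inner_conj_symm (e k) (f 1), mul_comm, Complex.mul_conj,
    mul_comm, Complex.mul_conj, Complex.normSq_eq_norm_sq, Complex.normSq_eq_norm_sq,
    Complex.ofReal_re, Complex.ofReal_re]

/-- An orthogonal measure, with its two weights in increasing order. -/
theorem IsOrthogonalMeasure.exists_ordered {μ : MeasureTheory.Measure PureState} {ω : Functional}
    (hω : ω ∈ stateSpace) (h : IsOrthogonalMeasure μ ω)
    (e : OrthonormalBasis (Fin 2) ℂ Qubit) :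
    ∃ (s r : ℝ≥0) (q q' : PureState), s ≤ r ∧ s + r = 1 ∧
      μ = s • MeasureTheory.Measure.dirac q + r • MeasureTheory.Measure.dirac q' ∧
      (∀ x : M₂, ω x = ((s : ℝ) : ℂ) * (q : Functional) x + ((r : ℝ) : ℂ) * (q' : Functional) x) ∧
      (∀ k, ((q : Functional) (ketbra (e k) (e k))).re +
        ((q' : Functional) (ketbra (e k) (e k))).re = 1) ∧
      stateDet e ω = s * r := by
  obtain ⟨a, f, p, hp, hsum, hμ⟩ := h
  have hp' : ∀ i, (p i : Functional) = vectorFunctional (f i) := fun i =>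
    isVectorState_iff.mp (hp i)
  have h1 := sum_weights_eq_one hω (fun i => isPure_mem_stateSpace (p i)) hsum
  have h1' : a 0 + a 1 = 1 := by exact_mod_cast h1
  have hk : ∀ k, ((p 0 : Functional) (ketbra (e k) (e k))).re +
      ((p 1 : Functional) (ketbra (e k) (e k))).re = 1 := fun k => by
    rw [hp', hp', sum_vectorFunctional_ketbra]
  have hdet : stateDet e ω = a 0 * a 1 :=
    stateDet_eq_mul hω e f fun x => by rw [hsum]; simp only [hp']
  rw [Fin.sum_univ_two] at hμ
  simp only [Fin.sum_univ_two] at hsum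
  rcases le_total (a 0) (a 1) with hle | hle
  · exact ⟨a 0, a 1, p 0, p 1, hle, h1', hμ, hsum, hk, hdet⟩
  · exact ⟨a 1, a 0, p 1, p 0, hle, by rw [add_comm, h1'], by rw [hμ, add_comm],
      fun x => by rw [hsum, add_comm], fun k => by rw [add_comm, hk], by rw [hdet, mul_comm]⟩

theorem QuantumMarkovSemigroup.satisfiesLDP_of_isAbsorbing {S : QuantumMarkovSemigroup}
    {e : OrthonormalBasis (Fin 2) ℂ Qubit} (h : S.IsAbsorbing (vectorFunctional (e 0)))
    {a : ℝ} (ha : 0 < a) (hdecay : ∀ t : ℝ≥0, S.decay e t = Real.exp (-(a * t)))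
    {ω : Functional} (hω : ω ∈ stateSpace) (hne : ω ≠ vectorFunctional (e 0)) :
    EveryOrthogonalNetLDP S ω (twoPointRate (basisState e 0) (basisState e 1) a) := by
  intro μ hμ
  choose s r q q' hsr hadd hμeq hsum hk hdet using fun t =>
    (hμ t).exists_ordered (S.predual_mem_stateSpace t hω) e
  obtain ⟨κ, hκ, hlow⟩ := eventually_le_stateDet h hω hne
  have haddR : ∀ t, (s t : ℝ) + r t = 1 := fun t => by exact_mod_cast hadd t
  have hhalf : ∀ t, (1 / 2 : ℝ) ≤ r t := fun t => by
    have : (s t : ℝ) ≤ r t := hsr t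
    linarith [haddR t]
  have hx1 : (ω (ketbra (e 1) (e 1))).re ≤ 1 := by
    linarith [state_ketbra_re_add hω e, state_ketbra_re_nonneg hω (e 0)]
  have hpop : ∀ t, (S.predual t ω (ketbra (e 1) (e 1))).re ≤ S.decay e t := fun t => by
    rw [predual_ketbra_one_re h]
    exact mul_le_of_le_one_right (S.decay_nonneg e t) hx1
  -- The heavier eigenstate carries weight at least `1/2`, so its population of `e 1` is at most
  -- twice that of the whole state.
  have hq'le : ∀ t, ((q' t : Functional) (ketbra (e 1) (e 1))).re ≤ 2 * S.decay e t := by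
    intro t
    have h1 := hpop t
    rw [hsum t, Complex.add_re, Complex.re_ofReal_mul, Complex.re_ofReal_mul] at h1
    have h2 := mul_nonneg (s t).coe_nonneg
      (state_ketbra_re_nonneg (isPure_mem_stateSpace (q t)) (e 1))
    have h3 := mul_le_mul_of_nonneg_right (hhalf t)
      (state_ketbra_re_nonneg (isPure_mem_stateSpace (q' t)) (e 1))
    linarith
  have hlim : Filter.Tendsto (fun t => ((q' t : Functional) (ketbra (e 1) (e 1))).re)
      Filter.atTop (𝓝 0) :=
    squeeze_zero (fun t => state_ketbra_re_nonneg (isPure_mem_stateSpace (q' t)) (e 1)) hq'le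
      (by simpa using (tendsto_decay h).const_mul 2)
  have hq' : Filter.Tendsto q' Filter.atTop (𝓝 (basisState e 0)) := tendsto_basisState e hlim
  have hq : Filter.Tendsto q Filter.atTop (𝓝 (basisState e 1)) := by
    rw [← basisState_swapBasis_zero]
    refine tendsto_basisState (swapBasis e) (hlim.congr fun t => ?_)
    rw [swapBasis_one]
    linarith [hk t 1, state_ketbra_re_add (isPure_mem_stateSpace (q t)) e]
  refine satisfiesLDP_twoPointRate (basisState_ne e) ha hμeq hadd hq hq' ?_ ?_
  -- The product `s * r` is the determinant, between `κ * decay` and `decay`; with `1/2 ≤ r ≤ 1`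
  -- this confines `s` between `κ * decay` and `2 * decay`.
  · refine tendsto_rpow_one_div (κ := κ) (K := 2) hκ ?_ (Filter.Eventually.of_forall fun t => ?_)
    · filter_upwards [hlow] with t ht
      rw [hdecay, hdet] at ht
      exact ht.trans (mul_le_of_le_one_right (s t).coe_nonneg
        (by linarith [haddR t, (s t).coe_nonneg]))
    · have h1 := (stateDet_le (S.predual_mem_stateSpace t hω) e).trans (hpop t)
      rw [hdet, hdecay] at h1
      have h2 := mul_le_mul_of_nonneg_left (hhalf t) (s t).coe_nonneg
      linarith
  · have := tendsto_rpow_one_div (f := r) (a := 0) (κ := 1 / 2) (K := 1) (by norm_num)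
      (Filter.Eventually.of_forall fun t => by simpa using hhalf t)
      (Filter.Eventually.of_forall fun t => by
        have := haddR t
        have := (s t).coe_nonneg
        simp only [zero_mul, neg_zero, Real.exp_zero, mul_one]
        linarith)
    simpa using this

/-! ### From the large deviation principle to an absorbing pure state -/

theorem continuous_vectorFunctional : Continuous vectorFunctional := by
  refine WeakDual.continuous_of_continuous_eval fun x => ?_
  simp only [vectorFunctional_apply]
  exact continuous_id.inner (LinearMap.continuous_of_finiteDimensional _)

theorem exists_basis_of_norm_eq_one {v : Qubit} (hv : ‖v‖ = 1) :
    ∃ e : OrthonormalBasis (Fin 2) ℂ Qubit, e 0 = v := by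
  obtain ⟨e, he⟩ := Orthonormal.exists_orthonormalBasis_extension_of_card_eq (𝕜 := ℂ)
    (E := Qubit) (ι := Fin 2) (by simp) (v := fun _ => v) (s := {0}) (by
      rw [orthonormal_iff_ite]
      intro i j
      rw [if_pos (Subsingleton.elim i j)]
      exact inner_self_eq_one_of_norm_eq_one hv)
  exact ⟨e, he 0 rfl⟩

instance : CompactSpace PureState := by
  rw [← isCompact_iff_compactSpace]
  have : stateSpace.extremePoints ℝ = vectorFunctional '' Metric.sphere 0 1 := by
    ext p
    constructor
    · intro hp
      obtain ⟨e, he⟩ := exists_basis_of_pureState ⟨p, hp⟩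
      exact ⟨e 0, by simp, (congrArg Subtype.val he).symm⟩
    · rintro ⟨v, hv, rfl⟩
      obtain ⟨e, rfl⟩ := exists_basis_of_norm_eq_one (v := v) (by simpa using hv)
      exact isPure_vectorFunctional e
  rw [this]
  exact (isCompact_sphere 0 1).image continuous_vectorFunctional

/-- A lower semicontinuous function attains its minimum on a compact set, so `J` is bounded away
from `0` on `F`. -/
theorem iSup_exp_neg_lt_one {X : Type*} [TopologicalSpace X] [CompactSpace X] {J : X → ℝ≥0∞}
    (hJ : LowerSemicontinuous J) {F : Set X} (hF : IsClosed F) (h : ∀ z ∈ F, J z ≠ 0) :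
    ⨆ z ∈ F, EReal.exp (-(J z : EReal)) < 1 := by
  rcases F.eq_empty_or_nonempty with rfl | hne
  · simp
  obtain ⟨z, hz, hmin⟩ := (hJ.lowerSemicontinuousOn F).exists_isMinOn hne hF.isCompact
  refine lt_of_le_of_lt (iSup₂_le (a := EReal.exp (-(J z : EReal))) fun w hw => ?_) ?_
  · rw [EReal.exp_le_exp_iff, EReal.neg_le_neg_iff]
    exact_mod_cast hmin hw
  · rw [EReal.exp_lt_one_iff, EReal.neg_lt_comm, neg_zero]
    exact_mod_cast pos_iff_ne_zero.mpr (h z hz)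

/-- For some `b < 1` the upper bound yields `μ t F ≤ b ^ t` eventually. -/
theorem SatisfiesLDP.tendsto_measure_zero {X : Type*} [TopologicalSpace X] [CompactSpace X]
    [MeasurableSpace X] {μ : ℝ≥0 → MeasureTheory.Measure X} {J : X → ℝ≥0∞}
    (h : SatisfiesLDP μ J) {F : Set X} (hF : IsClosed F) (hJ : ∀ z ∈ F, J z ≠ 0) :
    Filter.Tendsto (fun t => μ t F) Filter.atTop (𝓝 0) := by
  obtain ⟨b, hb, hb1⟩ := exists_between ((h.2.1 F hF).trans_lt (iSup_exp_neg_lt_one h.1 hF hJ))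
  have hev := Filter.eventually_lt_of_limsup_lt hb
  lift b to ℝ≥0 using hb1.ne_top
  have hb1' : (b : ℝ) < 1 := by exact_mod_cast hb1
  have hlim : Filter.Tendsto (fun t : ℝ≥0 => (b : ℝ≥0∞) ^ (t : ℝ)) Filter.atTop (𝓝 0) := by
    have h1 := (tendsto_rpow_atTop_of_base_lt_one (b : ℝ) (by linarith [b.coe_nonneg]) hb1').comp
      (NNReal.tendsto_coe_atTop.mpr Filter.tendsto_id)
    have h2 := ENNReal.tendsto_ofReal h1
    rw [ENNReal.ofReal_zero] at h2
    refine h2.congr fun t => ?_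
    rw [Function.comp_apply, id_eq, ← ENNReal.ofReal_rpow_of_nonneg b.coe_nonneg t.coe_nonneg,
      ENNReal.ofReal_coe_nnreal]
  refine tendsto_of_tendsto_of_tendsto_of_le_of_le' tendsto_const_nhds hlim
    (Filter.Eventually.of_forall fun _ => zero_le) ?_
  filter_upwards [hev, Filter.eventually_gt_atTop 0] with t ht hpos
  have hpos' : (0 : ℝ) < t := by exact_mod_cast hpos
  have := ENNReal.rpow_le_rpow ht.le hpos'.le
  rwa [← ENNReal.rpow_mul, one_div_mul_cancel hpos'.ne', ENNReal.rpow_one] at this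

/-- The state is the barycentre of `μ`. Atoms outside the bad set contribute at most `ε` in total;
each of the two atoms inside contributes at most `2 * C` times the mass of the set, whence the `4`.
-/
theorem norm_sub_le_of_measure {μ : MeasureTheory.Measure PureState} {ω : Functional}
    (hω : ω ∈ stateSpace) (h : IsOrthogonalMeasure μ ω) (p : PureState) (x : M₂) {C ε : ℝ}
    (hC : ∀ q : PureState, ‖(q : Functional) x‖ ≤ C) (hε : 0 ≤ ε) :
    ‖ω x - (p : Functional) x‖ ≤
      ε + 4 * C * (μ {q : PureState | ε ≤ ‖(q : Functional) x - (p : Functional) x‖}).toReal := by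
  obtain ⟨a, f, q, -, hsum, rfl⟩ := h
  set F := {q : PureState | ε ≤ ‖(q : Functional) x - (p : Functional) x‖}
  have h1 := sum_weights_eq_one hω (fun i => isPure_mem_stateSpace (q i)) hsum
  have hC0 : 0 ≤ C := (norm_nonneg _).trans (hC p)
  set m := ((∑ i, a i • MeasureTheory.Measure.dirac (q i)) F).toReal with hm
  have hm0 : 0 ≤ m := ENNReal.toReal_nonneg
  have hfin : (∑ i, a i • MeasureTheory.Measure.dirac (q i)) F ≠ ⊤ := by
    rw [Fin.sum_univ_two]
    exact MeasureTheory.measure_ne_top _ F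
  have hterm : ∀ i, (a i : ℝ) * ‖(q i : Functional) x - (p : Functional) x‖ ≤
      a i * ε + 2 * C * m := by
    intro i
    by_cases hi : q i ∈ F
    · have ham : (a i : ℝ) ≤ m := by
        rw [hm, ← ENNReal.ofReal_le_iff_le_toReal hfin, ENNReal.ofReal_coe_nnreal,
          MeasureTheory.Measure.finsetSum_apply]
        refine le_trans ?_ (Finset.single_le_sum (fun _ _ => zero_le) (Finset.mem_univ i))
        rw [MeasureTheory.Measure.smul_apply, MeasureTheory.Measure.dirac_apply_of_mem hi]
        simp [ENNReal.smul_def]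
      have hn : ‖(q i : Functional) x - (p : Functional) x‖ ≤ 2 * C := by
        refine (norm_sub_le _ _).trans ?_
        linarith [hC (q i), hC p]
      have := mul_le_mul ham hn (norm_nonneg _) hm0
      have h3 := mul_nonneg (a i).coe_nonneg hε
      linarith
    · have hlt : ‖(q i : Functional) x - (p : Functional) x‖ ≤ ε := (not_le.mp hi).le
      have := mul_le_mul_of_nonneg_left hlt (a i).coe_nonneg
      have h3 : 0 ≤ 2 * C * m := by positivity
      linarith
  have heq : ω x - (p : Functional) x =
      ((a 0 : ℝ) : ℂ) * ((q 0 : Functional) x - (p : Functional) x) +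
      ((a 1 : ℝ) : ℂ) * ((q 1 : Functional) x - (p : Functional) x) := by
    rw [hsum, Fin.sum_univ_two]
    have : ((a 0 : ℝ) : ℂ) + ((a 1 : ℝ) : ℂ) = 1 := by exact_mod_cast h1
    linear_combination (p : Functional) x * this
  rw [heq]
  refine (norm_add_le _ _).trans ?_
  rw [norm_mul, norm_mul, Complex.norm_real, Complex.norm_real,
    Real.norm_of_nonneg (a 0).coe_nonneg, Real.norm_of_nonneg (a 1).coe_nonneg]
  have h2 : (a 0 : ℝ) * ε + a 1 * ε = ε := by rw [← add_mul, h1, one_mul]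
  linarith [hterm 0, hterm 1]

theorem tendsto_of_satisfiesLDP {ω : ℝ≥0 → Functional} (hω : ∀ t, ω t ∈ stateSpace)
    {μ : ℝ≥0 → MeasureTheory.Measure PureState} (hμ : ∀ t, IsOrthogonalMeasure (μ t) (ω t))
    {J : PureState → ℝ≥0∞} {p : PureState} (hJ : ∀ q, J q = 0 ↔ q = p) (h : SatisfiesLDP μ J) :
    Filter.Tendsto ω Filter.atTop (𝓝 (p : Functional)) := by
  refine tendsto_functional_iff.mpr fun x => ?_
  have hcont : Continuous fun q : PureState => (q : Functional) x :=
    (WeakDual.eval_continuous x).comp continuous_subtype_val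
  obtain ⟨C, hC⟩ := (isCompact_range hcont).isBounded.exists_norm_le
  have hC' : ∀ q : PureState, ‖(q : Functional) x‖ ≤ C := fun q => hC _ ⟨q, rfl⟩
  rw [Metric.tendsto_nhds]
  intro ε hε
  have hlim := h.tendsto_measure_zero (F := {q : PureState | ε / 2 ≤
      ‖(q : Functional) x - (p : Functional) x‖})
    (isClosed_le continuous_const (hcont.sub continuous_const).norm) (fun z hz hz0 => by
      rw [(hJ z).mp hz0, Set.mem_ofPred_eq, sub_self, norm_zero] at hz
      linarith)
  have hreal := ((ENNReal.tendsto_toReal ENNReal.zero_ne_top).comp hlim).const_mul (4 * C)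
  rw [ENNReal.toReal_zero, mul_zero] at hreal
  filter_upwards [hreal.eventually_lt_const (half_pos hε)] with t ht
  rw [dist_eq_norm]
  have := norm_sub_le_of_measure (hω t) (hμ t) p x hC' (half_pos hε).le
  rw [Function.comp_apply] at ht
  linarith

theorem QuantumMarkovSemigroup.isAbsorbing_of_forall_ne {S : QuantumMarkovSemigroup}
    {p : PureState} (h : ∀ ω ∈ stateSpace, ω ≠ p →
      Filter.Tendsto (fun t => S.predual t ω) Filter.atTop (𝓝 (p : Functional))) :
    S.IsAbsorbing p := by
  refine ⟨isPure_mem_stateSpace p, fun ω hω => ?_⟩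
  by_cases hne : ω = p
  swap
  · exact h ω hω hne
  obtain ⟨e, rfl⟩ := exists_basis_of_pureState p
  subst hne
  have hq := isPure_mem_stateSpace (basisState e 1)
  have hqne : (basisState e 1 : Functional) ≠ basisState e 0 := fun h0 =>
    basisState_ne e (Subtype.ext h0.symm)
  -- The excluded state is `2σ - q`, where `q` is the orthogonal pure state and `σ` the midpoint;
  -- both differ from it, so their orbits converge.
  set σ : Functional := (1 / 2 : ℂ) • (basisState e 0 : Functional) +
    (1 / 2 : ℂ) • (basisState e 1 : Functional) with hσ
  have hσx : ∀ x, σ x = 1 / 2 * (basisState e 0 : Functional) x +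
      1 / 2 * (basisState e 1 : Functional) x := fun x => rfl
  have hσs : σ ∈ stateSpace := by
    refine ⟨fun x hx => ?_, ?_⟩
    · rw [hσx]
      have h2 : (0 : ℂ) ≤ 1 / 2 := by
        rw [one_div]; exact inv_nonneg.mpr zero_le_two
      exact add_nonneg (mul_nonneg h2 (hω.1 x hx)) (mul_nonneg h2 (hq.1 x hx))
    · rw [hσx, hω.2, hq.2]; norm_num
  have hσne : σ ≠ basisState e 0 := fun h0 => hqne <| DFunLike.ext _ _ fun x => by
    have h1 := hσx x
    rw [h0] at h1
    linear_combination -2 * h1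
  have l1 := tendsto_functional_iff.mp (h σ hσs hσne)
  have l2 := tendsto_functional_iff.mp (h _ hq hqne)
  refine tendsto_functional_iff.mpr fun x => ?_
  have l3 := ((l1 x).const_mul 2).sub (l2 x)
  rw [two_mul, add_sub_cancel_right] at l3
  refine l3.congr fun t => ?_
  rw [predual_apply, predual_apply, predual_apply, hσx]
  ring

theorem QuantumMarkovSemigroup.isAbsorbing_of_someOrthogonalNetLDP {S : QuantumMarkovSemigroup}
    {J : PureState → ℝ≥0∞} {p : PureState} (hJ : ∀ q, J q = 0 ↔ q = p)
    (h : ∀ ω ∈ stateSpace, ω ≠ p → SomeOrthogonalNetLDP S ω J) : S.IsAbsorbing p :=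
  isAbsorbing_of_forall_ne fun ω hω hne => by
    obtain ⟨μ, hμ, hLDP⟩ := h ω hω hne
    exact tendsto_of_satisfiesLDP (fun t => S.predual_mem_stateSpace t hω) hμ hJ hLDP

theorem QuantumMarkovSemigroup.IsAbsorbing.eq {S : QuantumMarkovSemigroup} {σ τ : Functional}
    (hσ : S.IsAbsorbing σ) (hτ : S.IsAbsorbing τ) : σ = τ :=
  tendsto_nhds_unique (hσ.2 σ hσ.1) (hτ.2 σ hσ.1)

/-- The spectral theorem supplies a net, so the universal statement is not vacuous. -/
theorem QuantumMarkovSemigroup.someOrthogonalNetLDP_of_every {S : QuantumMarkovSemigroup}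
    {ω : Functional} (hω : ω ∈ stateSpace) {J : PureState → ℝ≥0∞}
    (h : EveryOrthogonalNetLDP S ω J) : SomeOrthogonalNetLDP S ω J := by
  choose μ hμ using fun t => exists_isOrthogonalMeasure (S.predual_mem_stateSpace t hω)
  exact ⟨μ, hμ, h μ hμ⟩

theorem mainTheorem4 (S : QuantumMarkovSemigroup) :
    List.TFAE [
      ∃ p : PureState, S.IsAbsorbing p,
      ∃ (J : PureState → ℝ≥0∞) (p : PureState), (∀ q, J q = 0 ↔ q = p) ∧
        ∀ ω ∈ stateSpace, ω ≠ p → EveryOrthogonalNetLDP S ω J,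
      ∃ (J : PureState → ℝ≥0∞) (p : PureState), (∀ q, J q = 0 ↔ q = p) ∧
        ∀ ω ∈ stateSpace, ω ≠ p → SomeOrthogonalNetLDP S ω J] ∧
    ∀ (J : PureState → ℝ≥0∞) (p : PureState), (∀ q, J q = 0 ↔ q = p) →
      (∀ ω ∈ stateSpace, ω ≠ p → SomeOrthogonalNetLDP S ω J) →
      S.IsAbsorbing p ∧ ∀ σ : Functional, S.IsAbsorbing σ → σ = p := by
  refine ⟨?_, fun J p hJ h => ?_⟩
  · tfae_have 1 → 2 := by
      rintro ⟨p, hp⟩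
      obtain ⟨e, rfl⟩ := exists_basis_of_pureState p
      obtain ⟨a, ha, hdecay⟩ := QuantumMarkovSemigroup.exists_decay_eq_exp hp
      exact ⟨_, basisState e 0, twoPointRate_eq_zero_iff ha, fun ω hω hne =>
        QuantumMarkovSemigroup.satisfiesLDP_of_isAbsorbing hp ha hdecay hω hne⟩
    tfae_have 2 → 3 := fun ⟨J, p, hJ, h⟩ => ⟨J, p, hJ, fun ω hω hne =>
      QuantumMarkovSemigroup.someOrthogonalNetLDP_of_every hω (h ω hω hne)⟩
    tfae_have 3 → 1 := fun ⟨_, p, hJ, h⟩ =>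
      ⟨p, QuantumMarkovSemigroup.isAbsorbing_of_someOrthogonalNetLDP hJ h⟩
    tfae_finish
  · have hp := QuantumMarkovSemigroup.isAbsorbing_of_someOrthogonalNetLDP hJ h
    exact ⟨hp, fun σ hσ => hσ.eq hp⟩
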